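/- Let $k$ be a commutative ring in which $2$ is invertible, and let $A$ be a commutative $k$-algebra with an involution $\theta$ (a $k$-algebra endomorphism with $\theta\circ\theta=\mathrm{id}_A$). Put $A^{\theta}=\{a\in A:\theta(a)=a\}$ and $A^{-\theta}=\{a\in A:\theta(a)=-a\}$. Let $k[t]$ act on the Laurent polynomial ring $A[\sqrt{t}^{\pm1}]$ through $t=(\sqrt{t})^2$, let the contraction algebra $\mathbf{A}$ be the $k[t]$-subalgebra of $A[\sqrt{t}^{\pm1}]$ generated by $A^{\theta}$ and $\frac{1}{\sqrt{t}}A^{-\theta}$, and let $\mathbf{A}_0=\mathbf{A}/(t)$. Let $I\subset A$ be the ideal generated by $A^{-\theta}$. Suppose that $A$ is smooth over $k$. Then: 1. There exists an isomorphism $\mathbf{A}_0\cong\mathrm{Sym}_{A/I}(I/I^2)$ of $k$-algebras, where $\mathrm{Sym}_{A/I}(I/I^2)$ is the symmetric algebra of the $A/I$-module $I/I^2$. In particular, $\mathbf{A}_0$ is smooth over $k$. 2. The $k[t]$-algebra $\mathbf{A}$ is smooth. -/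

import Mathlib

open scoped Polynomial LaurentPolynomial

noncomputable section

namespace Contraction

universe u v

variable {k : Type u} {A : Type v} [CommRing k] [CommRing A] [Algebra k A]

/-- The fixed points `A^θ = {a | θ a = a}` of an endomorphism `θ` of `A`. -/
def invariants (θ : A →ₐ[k] A) : Set A := {a | θ a = a}

/-- The anti-invariants `A^{-θ} = {a | θ a = -a}` of an endomorphism `θ` of `A`. -/
def antiInvariants (θ : A →ₐ[k] A) : Set A := {a | θ a = -a}

/-- The ideal `I` of `A` generated by `A^{-θ}`. -/
def antiIdeal (θ : A →ₐ[k] A) : Ideal A := Ideal.span (antiInvariants θ)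

variable (k A) in
/-- The `k[t]`-algebra structure of `A[√t, 1/√t]`: the variable `T` of the Laurent polynomial ring
`A[T;T⁻¹]` plays the role of `√t`, and so `t` acts as `T ^ 2`. This is not a global instance. -/
abbrev laurentAlgebra : Algebra k[X] A[T;T⁻¹] :=
  (Polynomial.aeval (R := k) (LaurentPolynomial.T 2 : A[T;T⁻¹])).toRingHom.toAlgebra

/-- The generators `A^θ` and `(1/√t) A^{-θ}` in `A[√t, 1/√t]`. -/
def generators (θ : A →ₐ[k] A) : Set A[T;T⁻¹] :=
  {x | ∃ a ∈ invariants θ, x = LaurentPolynomial.C a} ∪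
  {x | ∃ a ∈ antiInvariants θ, x = LaurentPolynomial.C a * LaurentPolynomial.T (-1)}

section

attribute [local instance] laurentAlgebra

/-- The `k[t]`-subalgebra of `A[√t, 1/√t]` generated by `A^θ` and `(1/√t) A^{-θ}`. -/
def contractionSubalgebra (θ : A →ₐ[k] A) : Subalgebra k[X] A[T;T⁻¹] :=
  Algebra.adjoin k[X] (generators θ)

/-- The contraction algebra `𝐀` of `(A, θ)`, as a type. -/
def ContractionAlgebra (θ : A →ₐ[k] A) : Type v := contractionSubalgebra θ

instance (θ : A →ₐ[k] A) : CommRing (ContractionAlgebra θ) :=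
  inferInstanceAs (CommRing (contractionSubalgebra θ))

/-- `𝐀` as an algebra over `k[t]` (the variable `X` of `k[X]` is `t`). -/
instance (θ : A →ₐ[k] A) : Algebra k[X] (ContractionAlgebra θ) :=
  inferInstanceAs (Algebra k[X] (contractionSubalgebra θ))

end

/-- `𝐀` as an algebra over `k`, by restriction along `k → k[t]`. -/
instance (θ : A →ₐ[k] A) : Algebra k (ContractionAlgebra θ) :=
  ((algebraMap k[X] (ContractionAlgebra θ)).comp Polynomial.C).toAlgebra

instance (θ : A →ₐ[k] A) : IsScalarTower k k[X] (ContractionAlgebra θ) :=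
  IsScalarTower.of_algebraMap_eq' rfl

/-- The fiber `𝐀 / (t)` of the contraction algebra at `t = 0`. -/
abbrev FiberZero (θ : A →ₐ[k] A) : Type v :=
  ContractionAlgebra θ ⧸
    Ideal.span {algebraMap k[X] (ContractionAlgebra θ) (Polynomial.X : k[X])}

/-- The symmetric algebra `Sym_{A/I} (I/I²)` of the `A/I`-module `I/I²`. -/
def SymCotangent (I : Ideal A) : Type v := SymmetricAlgebra (A ⧸ I) I.Cotangent

instance (I : Ideal A) : CommRing (SymCotangent I) :=
  inferInstanceAs (CommRing (SymmetricAlgebra (A ⧸ I) I.Cotangent))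

instance (I : Ideal A) : Algebra (A ⧸ I) (SymCotangent I) :=
  inferInstanceAs (Algebra (A ⧸ I) (SymmetricAlgebra (A ⧸ I) I.Cotangent))

/-- `Sym_{A/I} (I/I²)` as an algebra over `k`, by restriction along `k → A/I`. -/
instance (I : Ideal A) : Algebra k (SymCotangent I) :=
  ((algebraMap (A ⧸ I) (SymCotangent I)).comp (algebraMap k (A ⧸ I))).toAlgebra

instance (I : Ideal A) : IsScalarTower k (A ⧸ I) (SymCotangent I) :=
  IsScalarTower.of_algebraMap_eq' rfl

end Contraction

end

/-!
For a `k[t]`-algebra `B`, consider the `k`-algebra homomorphisms `A → B[s] / (s² - t)` which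
intertwine `θ` with `s ↦ -s`. Choosing finitely many generators of `A`, each of them even or
odd, shows that this functor of `B` is represented by a `k[t]`-algebra `𝐁` of finite presentation
(`HomogeneousGenerators.Model`): the even generators `x` and the odd generators `y` are sent to
`x` and `s y`, and every relation of `A` gives two relations of `𝐁`.

* `𝐁` is smooth over `k[t]` (`HomogeneousGenerators.smooth_model`). Along a square-zero extension,
  a homomorphism out of `A` lifts because `A` is formally smooth; as `2` is invertible, the mean of
  the lift and of its conjugate is a lift which is equivariant.
* `𝐁` is the contraction algebra (`HomogeneousGenerators.nonempty_algEquiv_contractionAlgebra`).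
  The equivariant homomorphism `a ↦ a₊ + s (a₋ / √t)` induces a map `𝐁 → A[√t, 1/√t]` with image the
  contraction algebra. It becomes injective after inverting `t`, and `t` is not a zero divisor of
  `𝐁`, because smooth algebras are flat.
* `𝐁 / (t)` is the symmetric algebra of `I / I²` over `A / I`
  (`HomogeneousGenerators.nonempty_fiber_algEquiv_symCotangent`). For `t = 0`, the constant
  coefficient of an equivariant homomorphism `A → B[s] / (s²)` is a homomorphism that kills `I`, and
  its coefficient at `s` restricts to an `A / I`-linear map `I / I² → B`; the pair determines the
  homomorphism because the odd part of `a ∈ I` is congruent to `a` modulo `I²`. This step needs no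
  smoothness.
-/

namespace Contraction

/-! ### Even and odd parts for an involution -/

section Parts

variable {k A : Type*} [CommRing k] [CommRing A] [Algebra k A]

theorem eq_zero_of_add_self [Invertible (2 : k)] {M : Type*} [AddCommGroup M] [Module k M] {x : M}
    (h : x + x = 0) : x = 0 := by
  have : (2 : k) • x = 0 := by rw [two_smul, h]
  rw [← one_smul k x, ← invOf_mul_self (2 : k), mul_smul, this, smul_zero]

variable (k A) in
theorem algebraMap_invOf_two_mul_two [Invertible (2 : k)] : algebraMap k A ⅟2 * 2 = 1 := by
  rw [← map_ofNat (algebraMap k A) 2, ← map_mul, invOf_mul_self, map_one]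

variable [Invertible (2 : k)] (θ : A →ₐ[k] A)

/-- The even part `(a + θ a) / 2` of `a`. -/
noncomputable def evenPart : A →ₗ[k] A := (⅟2 : k) • (LinearMap.id + θ.toLinearMap)

/-- The odd part `(a - θ a) / 2` of `a`. -/
noncomputable def oddPart : A →ₗ[k] A := (⅟2 : k) • (LinearMap.id - θ.toLinearMap)

theorem evenPart_apply (a : A) : evenPart θ a = (⅟2 : k) • (a + θ a) := rfl

theorem oddPart_apply (a : A) : oddPart θ a = (⅟2 : k) • (a - θ a) := rfl

theorem evenPart_add_oddPart (a : A) : evenPart θ a + oddPart θ a = a := by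
  rw [evenPart_apply, oddPart_apply, ← smul_add, add_add_sub_cancel, ← two_smul k a, smul_smul,
    invOf_mul_self, one_smul]

variable {θ}

theorem evenPart_of_mem {a : A} (ha : a ∈ invariants θ) : evenPart θ a = a := by
  rw [evenPart_apply, show θ a = a from ha, ← two_smul k a, smul_smul, invOf_mul_self, one_smul]

theorem oddPart_of_mem_invariants {a : A} (ha : a ∈ invariants θ) : oddPart θ a = 0 := by
  rw [oddPart_apply, show θ a = a from ha, sub_self, smul_zero]

theorem oddPart_of_mem {a : A} (ha : a ∈ antiInvariants θ) : oddPart θ a = a := by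
  rw [oddPart_apply, show θ a = -a from ha, sub_neg_eq_add, ← two_smul k a, smul_smul,
    invOf_mul_self, one_smul]

theorem evenPart_of_mem_antiInvariants {a : A} (ha : a ∈ antiInvariants θ) : evenPart θ a = 0 := by
  rw [evenPart_apply, show θ a = -a from ha, add_neg_cancel, smul_zero]

theorem evenPart_mem (hθ : Function.Involutive θ) (a : A) : evenPart θ a ∈ invariants θ := by
  change θ (evenPart θ a) = _
  rw [evenPart_apply, map_smul, map_add, hθ a, add_comm]

theorem oddPart_mem (hθ : Function.Involutive θ) (a : A) : oddPart θ a ∈ antiInvariants θ := by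
  change θ (oddPart θ a) = -_
  rw [oddPart_apply, map_smul, map_sub, hθ a, ← smul_neg, neg_sub]

theorem evenPart_mul (a b : A) :
    evenPart θ (a * b) = evenPart θ a * evenPart θ b + oddPart θ a * oddPart θ b := by
  have h := algebraMap_invOf_two_mul_two k A
  simp only [evenPart_apply, oddPart_apply, map_mul, Algebra.smul_def]
  linear_combination (-(a * b + θ a * θ b) * (algebraMap k A ⅟2)) * h

theorem oddPart_mul (a b : A) :
    oddPart θ (a * b) = evenPart θ a * oddPart θ b + oddPart θ a * evenPart θ b := by
  have h := algebraMap_invOf_two_mul_two k A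
  simp only [evenPart_apply, oddPart_apply, map_mul, Algebra.smul_def]
  linear_combination (-(a * b - θ a * θ b) * (algebraMap k A ⅟2)) * h

/-- The mean of two algebra homomorphisms whose difference squares to zero. -/
noncomputable def average {C : Type*} [CommRing C] [Algebra k C] (φ ψ : A →ₐ[k] C)
    (h : ∀ a b, (φ a - ψ a) * (φ b - ψ b) = 0) : A →ₐ[k] C :=
  AlgHom.ofLinearMap ((⅟2 : k) • (φ.toLinearMap + ψ.toLinearMap))
    (by
      change (⅟2 : k) • (φ 1 + ψ 1) = 1
      rw [map_one, map_one, ← two_smul k (1 : C), smul_smul, invOf_mul_self, one_smul])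
    (by
      intro a b
      change (⅟2 : k) • (φ (a * b) + ψ (a * b)) =
        ((⅟2 : k) • (φ a + ψ a)) * ((⅟2 : k) • (φ b + ψ b))
      have h2 := algebraMap_invOf_two_mul_two k C
      simp only [map_mul, Algebra.smul_def]
      linear_combination (-(φ a * φ b + ψ a * ψ b) * (algebraMap k C ⅟2)) * h2 +
        (algebraMap k C ⅟2) ^ 2 * h a b)

theorem average_apply {C : Type*} [CommRing C] [Algebra k C] (φ ψ : A →ₐ[k] C)
    (h : ∀ a b, (φ a - ψ a) * (φ b - ψ b) = 0) (a : A) :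
    average φ ψ h a = (⅟2 : k) • (φ a + ψ a) := rfl

end Parts

/-! ### Adjoining a square root of the parameter -/

section Quad

variable (k : Type*) {R : Type*} [CommRing k] [CommRing R] (t : R)

/-- The algebra `B[s] / (s² - t)`, for an algebra `B` over a ring with a marked element `t`. -/
abbrev Quad (B : Type*) [CommRing B] [Algebra R B] : Type _ :=
  QuadraticAlgebra B (algebraMap R B t) 0

namespace Quad

variable {B C : Type*} [CommRing B] [Algebra R B] [Algebra k B]
  [CommRing C] [Algebra R C] [Algebra k C]

/-- The involution `s ↦ -s` of `B[s] / (s² - t)`. -/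
def conj : Quad t B →ₐ[k] Quad t B where
  toFun z := ⟨z.re, -z.im⟩
  map_one' := by ext <;> simp [QuadraticAlgebra.re_one, QuadraticAlgebra.im_one]
  map_mul' x y := by ext <;> simp; ring
  map_zero' := by ext <;> simp
  map_add' x y := by ext <;> simp; ring
  commutes' c := by
    ext
    · rfl
    · exact neg_zero

@[simp] theorem re_conj (z : Quad t B) : (conj k t z).re = z.re := rfl

@[simp] theorem im_conj (z : Quad t B) : (conj k t z).im = -z.im := rfl

variable [Algebra k R] [IsScalarTower k R B] [IsScalarTower k R C]

/-- Functoriality of `B[s] / (s² - t)` in `B`. -/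
def map (g : B →ₐ[R] C) : Quad t B →ₐ[k] Quad t C where
  toFun z := ⟨g z.re, g z.im⟩
  map_one' := by ext <;> simp [QuadraticAlgebra.re_one, QuadraticAlgebra.im_one]
  map_mul' x y := by ext <;> simp
  map_zero' := by ext <;> simp
  map_add' x y := by ext <;> simp
  commutes' c := by
    ext
    · exact (g.restrictScalars k).commutes c
    · exact map_zero g

@[simp] theorem re_map (g : B →ₐ[R] C) (z : Quad t B) : (map k t g z).re = g z.re := rfl

@[simp] theorem im_map (g : B →ₐ[R] C) (z : Quad t B) : (map k t g z).im = g z.im := rfl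

theorem map_mk (g : B →ₐ[R] C) (x y : B) : map k t g ⟨x, y⟩ = ⟨g x, g y⟩ := rfl

end Quad

end Quad

section Equivariant

variable {k A R B : Type*} [CommRing k] [CommRing A] [Algebra k A] {θ : A →ₐ[k] A}
  [CommRing R] {t : R} [CommRing B] [Algebra R B] [Algebra k B] [Invertible (2 : k)]
  {φ : A →ₐ[k] Quad t B}

/-- An equivariant homomorphism maps even elements to constants. -/
theorem equivariant_evenPart (hφ : ∀ a, φ (θ a) = Quad.conj k t (φ a)) (a : A) :
    φ (evenPart θ a) = ⟨(φ a).re, 0⟩ := by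
  rw [evenPart_apply, map_smul, map_add, hφ]
  refine QuadraticAlgebra.ext ?_ ?_
  · change (⅟2 : k) • ((φ a).re + (φ a).re) = (φ a).re
    rw [← two_smul k (φ a).re, smul_smul, invOf_mul_self, one_smul]
  · change (⅟2 : k) • ((φ a).im + -(φ a).im) = 0
    rw [add_neg_cancel, smul_zero]

/-- An equivariant homomorphism maps odd elements to multiples of `s`. -/
theorem equivariant_oddPart (hφ : ∀ a, φ (θ a) = Quad.conj k t (φ a)) (a : A) :
    φ (oddPart θ a) = ⟨0, (φ a).im⟩ := by
  rw [oddPart_apply, map_smul, map_sub, hφ]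
  refine QuadraticAlgebra.ext ?_ ?_
  · change (⅟2 : k) • ((φ a).re - (φ a).re) = 0
    rw [sub_self, smul_zero]
  · change (⅟2 : k) • ((φ a).im - -(φ a).im) = (φ a).im
    rw [sub_neg_eq_add, ← two_smul k (φ a).im, smul_smul, invOf_mul_self, one_smul]

end Equivariant

/-! ### The algebra representing equivariant homomorphisms to `B[s] / (s² - t)` -/

/-- A family of generators of a `k`-algebra `A` with an involution, each of them either invariant
(`even`) or anti-invariant (`odd`). -/
structure HomogeneousGenerators {k A : Type*} [CommRing k] [CommRing A] [Algebra k A]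
    (θ : A →ₐ[k] A) (ι κ : Type*) where
  /-- The invariant generators. -/
  even : ι → A
  /-- The anti-invariant generators. -/
  odd : κ → A
  even_mem : ∀ i, even i ∈ invariants θ
  odd_mem : ∀ j, odd j ∈ antiInvariants θ
  surjective_aeval :
    Function.Surjective (MvPolynomial.aeval (Sum.elim even odd) : MvPolynomial (ι ⊕ κ) k →ₐ[k] A)

/-- An algebra of finite type has a finite family of homogeneous generators, formed by the even and
odd parts of arbitrary generators. -/
theorem exists_homogeneousGenerators {k A : Type*} [CommRing k] [CommRing A] [Algebra k A]
    [Invertible (2 : k)] {θ : A →ₐ[k] A} (hθ : Function.Involutive θ) [Algebra.FiniteType k A] :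
    ∃ n : ℕ, Nonempty (HomogeneousGenerators θ (Fin n) (Fin n)) := by
  obtain ⟨n, f, hf⟩ := Algebra.FiniteType.iff_quotient_mvPolynomial''.mp ‹Algebra.FiniteType k A›
  refine ⟨n, ⟨⟨fun i => evenPart θ (f (.X i)), fun i => oddPart θ (f (.X i)),
    fun i => evenPart_mem hθ _, fun i => oddPart_mem hθ _, ?_⟩⟩⟩
  have : f = (MvPolynomial.aeval (Sum.elim (fun i => evenPart θ (f (.X i)))
      (fun i => oddPart θ (f (.X i))))).comp
        (MvPolynomial.aeval fun i => .X (.inl i) + .X (.inr i)) := by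
    ext i
    simp [evenPart_add_oddPart]
  rw [this] at hf
  exact Function.Surjective.of_comp (g := MvPolynomial.aeval _) hf

namespace HomogeneousGenerators

variable {k A : Type*} [CommRing k] [CommRing A] [Algebra k A] {θ : A →ₐ[k] A} {ι κ : Type*}
  (G : HomogeneousGenerators θ ι κ) {R : Type*} [CommRing R] [Algebra k R] (t : R)

variable (k ι κ) in
/-- The homomorphism `p(x, y) ↦ p(x, s y)` to `R[x, y][s] / (s² - t)`. -/
noncomputable def scaleOdd : MvPolynomial (ι ⊕ κ) k →ₐ[k] Quad t (MvPolynomial (ι ⊕ κ) R) :=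
  MvPolynomial.aeval (Sum.elim (fun i => ⟨.X (.inl i), 0⟩) (fun j => ⟨0, .X (.inr j)⟩))

@[simp] theorem scaleOdd_X_inl (i : ι) :
    scaleOdd k ι κ t (.X (.inl i)) = ⟨.X (.inl i), 0⟩ :=
  MvPolynomial.aeval_X _ _

@[simp] theorem scaleOdd_X_inr (j : κ) :
    scaleOdd k ι κ t (.X (.inr j)) = ⟨0, .X (.inr j)⟩ :=
  MvPolynomial.aeval_X _ _

/-- The relations of the representing algebra: both coordinates of `p(x, s y)`, for `p` running
through the relations among the generators of `A`. -/
noncomputable def relations : Ideal (MvPolynomial (ι ⊕ κ) R) :=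
  Ideal.span (⋃ p ∈ RingHom.ker (MvPolynomial.aeval (R := k) (Sum.elim G.even G.odd)),
    {(scaleOdd k ι κ t p).re, (scaleOdd k ι κ t p).im})

/-- The elements whose two coordinates lie in `N`. -/
def coordIdeal {B : Type*} [CommRing B] [Algebra R B] (N : Ideal B) : Ideal (Quad t B) where
  carrier := {z | z.re ∈ N ∧ z.im ∈ N}
  add_mem' hx hy := ⟨N.add_mem hx.1 hy.1, N.add_mem hx.2 hy.2⟩
  zero_mem' := ⟨N.zero_mem, N.zero_mem⟩
  smul_mem' c x hx := by
    simp only [smul_eq_mul, Set.mem_ofPred_eq, QuadraticAlgebra.re_mul, QuadraticAlgebra.im_mul,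
      zero_mul, add_zero]
    exact ⟨N.add_mem (N.mul_mem_left _ hx.1) (N.mul_mem_left _ hx.2),
      N.add_mem (N.mul_mem_left _ hx.2) (N.mul_mem_left _ hx.1)⟩

theorem relations_le_iff {N : Ideal (MvPolynomial (ι ⊕ κ) R)} :
    G.relations t ≤ N ↔ RingHom.ker (MvPolynomial.aeval (R := k) (Sum.elim G.even G.odd)) ≤
      (coordIdeal t N).comap (scaleOdd k ι κ t) := by
  simp only [relations, Ideal.span_le, Set.iUnion_subset_iff, Set.pair_subset_iff]
  rfl

theorem relations_fg [Finite ι] [Finite κ] [Algebra.FinitePresentation k A] :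
    (G.relations t).FG := by
  obtain ⟨S, hS⟩ := Algebra.FinitePresentation.ker_fG_of_surjective _ G.surjective_aeval
  refine ⟨(S.finite_toSet.biUnion (t := fun p =>
    {(scaleOdd k ι κ t p).re, (scaleOdd k ι κ t p).im}) fun p _ => Set.toFinite _).toFinset, ?_⟩
  rw [Set.Finite.coe_toFinset]
  apply le_antisymm
  · refine Ideal.span_mono (Set.iUnion₂_subset fun p hp => ?_)
    exact Set.subset_biUnion_of_mem (u := fun p =>
      ({(scaleOdd k ι κ t p).re, (scaleOdd k ι κ t p).im} : Set _))
      (show p ∈ RingHom.ker _ from hS.le (Ideal.subset_span hp))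
  · rw [relations_le_iff]
    refine hS.ge.trans (Ideal.span_le.mpr fun p hp => ⟨Ideal.subset_span ?_, Ideal.subset_span ?_⟩)
    · exact Set.mem_biUnion hp (Set.mem_insert _ _)
    · exact Set.mem_biUnion hp (Set.mem_insert_of_mem _ rfl)

/-- The `R`-algebra representing the functor which sends `B` to the set of `k`-algebra homomorphisms
`A → B[s] / (s² - t)` that intertwine `θ` with `s ↦ -s`. -/
abbrev Model : Type _ := MvPolynomial (ι ⊕ κ) R ⧸ G.relations t

instance finitePresentation_model [Finite ι] [Finite κ] [Algebra.FinitePresentation k A] :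
    Algebra.FinitePresentation R (G.Model t) :=
  Algebra.FinitePresentation.quotient (G.relations_fg t)

/-- The universal equivariant homomorphism `A → 𝐁[s] / (s² - t)`, for `𝐁` the representing
algebra. -/
noncomputable def universal : A →ₐ[k] Quad t (G.Model t) :=
  (Ideal.Quotient.liftₐ (RingHom.ker (MvPolynomial.aeval (R := k) (Sum.elim G.even G.odd)))
    ((Quad.map k t (Ideal.Quotient.mkₐ R (G.relations t))).comp (scaleOdd k ι κ t)) (by
      intro p hp
      have h := (G.relations_le_iff t).mp le_rfl hp
      ext
      · exact Ideal.Quotient.eq_zero_iff_mem.mpr h.1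
      · exact Ideal.Quotient.eq_zero_iff_mem.mpr h.2)).comp
  (Ideal.quotientKerAlgEquivOfSurjective G.surjective_aeval).symm.toAlgHom

theorem universal_aeval (p : MvPolynomial (ι ⊕ κ) k) :
    G.universal t (MvPolynomial.aeval (Sum.elim G.even G.odd) p) =
      Quad.map k t (Ideal.Quotient.mkₐ R (G.relations t)) (scaleOdd k ι κ t p) := by
  have : (Ideal.quotientKerAlgEquivOfSurjective G.surjective_aeval).symm
      (MvPolynomial.aeval (Sum.elim G.even G.odd) p) = Ideal.Quotient.mk _ p := by
    rw [AlgEquiv.symm_apply_eq]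
    rfl
  simp only [universal, AlgHom.comp_apply, AlgEquiv.coe_toAlgHom, this]
  rfl

theorem universal_even (i : ι) :
    G.universal t (G.even i) = ⟨Ideal.Quotient.mk _ (.X (.inl i)), 0⟩ := by
  have := G.universal_aeval t (.X (.inl i))
  rw [MvPolynomial.aeval_X, Sum.elim_inl] at this
  rw [this, scaleOdd_X_inl, Quad.map_mk, map_zero]
  rfl

theorem universal_odd (j : κ) :
    G.universal t (G.odd j) = ⟨0, Ideal.Quotient.mk _ (.X (.inr j))⟩ := by
  have := G.universal_aeval t (.X (.inr j))
  rw [MvPolynomial.aeval_X, Sum.elim_inr] at this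
  rw [this, scaleOdd_X_inr, Quad.map_mk, map_zero]
  rfl

theorem algHom_ext_generators {C : Type*} [CommRing C] [Algebra k C] {f g : A →ₐ[k] C}
    (he : ∀ i, f (G.even i) = g (G.even i)) (ho : ∀ j, f (G.odd j) = g (G.odd j)) : f = g := by
  have : f.comp (MvPolynomial.aeval (Sum.elim G.even G.odd)) =
      g.comp (MvPolynomial.aeval (Sum.elim G.even G.odd)) := by
    ext (i | j)
    · simpa using he i
    · simpa using ho j
  ext a
  obtain ⟨p, rfl⟩ := G.surjective_aeval a
  exact DFunLike.congr_fun this p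

theorem universal_map (a : A) : G.universal t (θ a) = Quad.conj k t (G.universal t a) := by
  refine DFunLike.congr_fun (f := (G.universal t).comp θ)
    (g := (Quad.conj k t).comp (G.universal t)) (G.algHom_ext_generators (fun i => ?_)
    fun j => ?_) a
  · rw [AlgHom.comp_apply, AlgHom.comp_apply, show θ (G.even i) = _ from G.even_mem i,
      universal_even]
    ext <;> simp
  · rw [AlgHom.comp_apply, AlgHom.comp_apply, show θ (G.odd j) = _ from G.odd_mem j, map_neg,
      universal_odd]
    ext <;> simp

/-- The coordinates of the universal homomorphism. -/
def coordinates : Set (G.Model t) :=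
  Set.range (fun a => (G.universal t a).re) ∪ Set.range (fun a => (G.universal t a).im)

theorem adjoin_coordinates : Algebra.adjoin R (G.coordinates t) = ⊤ := by
  rw [eq_top_iff]
  rintro x -
  obtain ⟨p, rfl⟩ := Ideal.Quotient.mk_surjective x
  induction p using MvPolynomial.induction_on with
  | C r => exact (Algebra.adjoin R _).algebraMap_mem r
  | add p q hp hq => rw [map_add]; exact add_mem hp hq
  | mul_X p n hp =>
    rw [map_mul]
    refine mul_mem hp (Algebra.subset_adjoin ?_)
    rcases n with i | j
    · exact .inl ⟨G.even i, by simp only [universal_even]⟩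
    · exact .inr ⟨G.odd j, by simp only [universal_odd]⟩

variable {C : Type*} [CommRing C] [Algebra R C]

variable {t} in
theorem model_algHom_ext {f g : G.Model t →ₐ[R] C}
    (hre : ∀ a, f (G.universal t a).re = g (G.universal t a).re)
    (him : ∀ a, f (G.universal t a).im = g (G.universal t a).im) : f = g := by
  refine AlgHom.ext_of_adjoin_eq_top (G.adjoin_coordinates t) ?_
  rintro _ (⟨a, rfl⟩ | ⟨a, rfl⟩)
  · exact hre a
  · exact him a

variable [Algebra k C] [IsScalarTower k R C]

/-- Every equivariant homomorphism factors through the universal one: equivariance, together with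
the invertibility of `2`, forces even generators to go to constants and odd ones to multiples of `s`. -/
theorem exists_lift [Invertible (2 : k)] (φ : A →ₐ[k] Quad t C)
    (hφ : ∀ a, φ (θ a) = Quad.conj k t (φ a)) :
    ∃ g : G.Model t →ₐ[R] C, ∀ a, Quad.map k t g (G.universal t a) = φ a := by
  have heven (i : ι) : (φ (G.even i)).im = 0 := by
    have := congr_arg QuadraticAlgebra.im (hφ (G.even i))
    rw [show θ (G.even i) = _ from G.even_mem i, Quad.im_conj, eq_neg_iff_add_eq_zero] at this
    exact eq_zero_of_add_self (k := k) this
  have hodd (j : κ) : (φ (G.odd j)).re = 0 := by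
    have := congr_arg QuadraticAlgebra.re (hφ (G.odd j))
    rw [show θ (G.odd j) = _ from G.odd_mem j, Quad.re_conj, map_neg, QuadraticAlgebra.re_neg,
      neg_eq_iff_add_eq_zero] at this
    exact eq_zero_of_add_self (k := k) this
  let g₀ : MvPolynomial (ι ⊕ κ) R →ₐ[R] C :=
    MvPolynomial.aeval (Sum.elim (fun i => (φ (G.even i)).re) (fun j => (φ (G.odd j)).im))
  have hg₀ : (Quad.map k t g₀).comp (scaleOdd k ι κ t) =
      φ.comp (MvPolynomial.aeval (Sum.elim G.even G.odd)) := by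
    refine MvPolynomial.algHom_ext fun n => ?_
    rcases n with i | j
    · rw [AlgHom.comp_apply, AlgHom.comp_apply, scaleOdd_X_inl, Quad.map_mk, map_zero,
        MvPolynomial.aeval_X, MvPolynomial.aeval_X]
      exact QuadraticAlgebra.ext rfl (heven i).symm
    · rw [AlgHom.comp_apply, AlgHom.comp_apply, scaleOdd_X_inr, Quad.map_mk, map_zero,
        MvPolynomial.aeval_X, MvPolynomial.aeval_X]
      exact QuadraticAlgebra.ext (hodd j).symm rfl
  have hker : G.relations t ≤ RingHom.ker g₀ := by
    rw [relations_le_iff]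
    intro p hp
    have h := DFunLike.congr_fun hg₀ p
    rw [AlgHom.comp_apply, AlgHom.comp_apply, RingHom.mem_ker.mp hp, map_zero] at h
    exact ⟨congr_arg QuadraticAlgebra.re h, congr_arg QuadraticAlgebra.im h⟩
  refine ⟨Ideal.Quotient.liftₐ _ g₀ hker, fun a => ?_⟩
  obtain ⟨p, rfl⟩ := G.surjective_aeval a
  rw [universal_aeval]
  exact DFunLike.congr_fun hg₀ p

end HomogeneousGenerators
/-! ### Smoothness of the representing algebra and of its fibers -/

namespace HomogeneousGenerators

variable {k A : Type*} [CommRing k] [CommRing A] [Algebra k A] {θ : A →ₐ[k] A} {ι κ : Type*}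
  (G : HomogeneousGenerators θ ι κ) {R : Type*} [CommRing R] [Algebra k R] (t : R)

/-- An equivariant homomorphism `A → (B / N)[s] / (s² - t)` with `N² = 0` lifts to
`B[s] / (s² - t)` because `A` is formally smooth, and the mean of a lift and of its conjugate is an
equivariant lift. -/
theorem formallySmooth_model [Invertible (2 : k)] (hθ : Function.Involutive θ)
    [Algebra.FormallySmooth k A] : Algebra.FormallySmooth R (G.Model t) := by
  refine .of_comp_surjective fun B _ _ N hN f => ?_
  let : Algebra k B := ((algebraMap R B).comp (algebraMap k R)).toAlgebra
  have : IsScalarTower k R B := .of_algebraMap_eq' rfl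
  let ρ : Quad t B →ₐ[k] Quad t (B ⧸ N) := Quad.map k t (Ideal.Quotient.mkₐ R N)
  have hρ : Function.Surjective ρ := by
    rintro ⟨x, y⟩
    obtain ⟨x, rfl⟩ := Ideal.Quotient.mk_surjective x
    obtain ⟨y, rfl⟩ := Ideal.Quotient.mk_surjective y
    exact ⟨⟨x, y⟩, rfl⟩
  have hN' {x y : B} (hx : x ∈ N) (hy : y ∈ N) : x * y = 0 := by
    have : x * y ∈ N ^ 2 := pow_two N ▸ Ideal.mul_mem_mul hx hy
    rwa [hN] at this
  have hker {z w : Quad t B} (hz : ρ z = 0) (hw : ρ w = 0) : z * w = 0 := by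
    have h (u : Quad t B) (hu : ρ u = 0) : u.re ∈ N ∧ u.im ∈ N :=
      ⟨Ideal.Quotient.eq_zero_iff_mem.mp (congr_arg QuadraticAlgebra.re hu),
        Ideal.Quotient.eq_zero_iff_mem.mp (congr_arg QuadraticAlgebra.im hu)⟩
    obtain ⟨hz₁, hz₂⟩ := h z hz
    obtain ⟨hw₁, hw₂⟩ := h w hw
    ext
    · simp [hN' hz₁ hw₁, mul_assoc, hN' hz₂ hw₂]
    · simp [hN' hz₁ hw₂, hN' hz₂ hw₁]
  have hnil : IsNilpotent (RingHom.ker (ρ : Quad t B →+* Quad t (B ⧸ N))) := by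
    refine ⟨2, ?_⟩
    rw [pow_two, Ideal.zero_eq_bot, eq_bot_iff, Ideal.mul_le]
    exact fun z hz w hw => hker hz hw
  let φ₀ : A →ₐ[k] Quad t (B ⧸ N) := (Quad.map k t f).comp (G.universal t)
  have hφ₀ (a : A) : Quad.conj k t (φ₀ (θ a)) = φ₀ a := by
    change Quad.conj k t (Quad.map k t f (G.universal t (θ a))) = Quad.map k t f (G.universal t a)
    rw [universal_map]
    ext <;> simp
  let φ₁ : A →ₐ[k] Quad t B := Algebra.FormallySmooth.liftOfSurjective φ₀ ρ hρ hnil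
  have hφ₁ (a : A) : ρ (φ₁ a) = φ₀ a :=
    Algebra.FormallySmooth.liftOfSurjective_apply φ₀ ρ hρ hnil a
  let φ₂ : A →ₐ[k] Quad t B := ((Quad.conj k t).comp φ₁).comp θ
  have hφ₂ (a : A) : ρ (φ₂ a) = φ₀ a := by
    rw [← hφ₀, ← hφ₁]
    ext
    · rfl
    · exact map_neg (Ideal.Quotient.mk N) _
  have hsub (a : A) : ρ (φ₁ a - φ₂ a) = 0 := by rw [map_sub, hφ₁, hφ₂, sub_self]
  obtain ⟨g, hg⟩ := G.exists_lift t (average φ₁ φ₂ fun a b => hker (hsub a) (hsub b)) (by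
    intro a
    rw [average_apply, average_apply, map_smul, map_add, add_comm]
    congr 2
    · change Quad.conj k t (φ₁ (θ (θ a))) = _
      rw [hθ a]
    · change _ = Quad.conj k t (Quad.conj k t (φ₁ (θ a)))
      ext <;> simp)
  have key (a : A) : Quad.map k t ((Ideal.Quotient.mkₐ R N).comp g) (G.universal t a) =
      Quad.map k t f (G.universal t a) := by
    change ρ (Quad.map k t g (G.universal t a)) = φ₀ a
    rw [hg, average_apply, map_smul, map_add, hφ₁, hφ₂, ← two_smul k (φ₀ a), smul_smul,
      invOf_mul_self, one_smul]
  exact ⟨g, G.model_algHom_ext (fun a => congr_arg QuadraticAlgebra.re (key a))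
    fun a => congr_arg QuadraticAlgebra.im (key a)⟩

theorem smooth_model [Invertible (2 : k)] (hθ : Function.Involutive θ) [Finite ι] [Finite κ]
    [Algebra.Smooth k A] : Algebra.Smooth R (G.Model t) where
  formallySmooth := G.formallySmooth_model t hθ

end HomogeneousGenerators

/-- Smoothness of the fiber at `t = 0`: a lifting problem over `k` is one over `k[t]`, with `t`
acting by zero. -/
theorem smooth_fiber_zero {k B : Type*} [CommRing k] [CommRing B] [Algebra k[X] B] [Algebra k B]
    [IsScalarTower k k[X] B] [Algebra.Smooth k[X] B] :
    Algebra.Smooth k (B ⧸ Ideal.span {algebraMap k[X] B Polynomial.X}) where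
  finitePresentation :=
    have : Algebra.FinitePresentation k k[X] := .polynomial k k
    have : Algebra.FinitePresentation k B := .trans k k[X] B
    .quotient ⟨{algebraMap k[X] B Polynomial.X}, by simp⟩
  formallySmooth := by
    refine .of_comp_surjective fun C _ _ N hN f => ?_
    let : Algebra k[X] C := (Polynomial.aeval (R := k) (0 : C)).toRingHom.toAlgebra
    have hX : algebraMap k[X] C Polynomial.X = 0 := Polynomial.aeval_X _
    let f₁ : B →ₐ[k] C ⧸ N := f.comp (Ideal.Quotient.mkₐ k _)
    have hf₁ : f₁.comp (IsScalarTower.toAlgHom k k[X] B) =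
        (Ideal.Quotient.mkₐ k N).comp (Polynomial.aeval (0 : C)) := by
      refine Polynomial.algHom_ext ?_
      have h : Ideal.Quotient.mk (Ideal.span {algebraMap k[X] B Polynomial.X})
          (algebraMap k[X] B Polynomial.X) = 0 :=
        Ideal.Quotient.eq_zero_iff_mem.mpr (Ideal.subset_span rfl)
      change f (Ideal.Quotient.mk _ (algebraMap k[X] B Polynomial.X)) =
        Ideal.Quotient.mk N (Polynomial.aeval 0 Polynomial.X)
      rw [h, map_zero, Polynomial.aeval_X, map_zero]
    obtain ⟨g, hg⟩ := Algebra.FormallySmooth.exists_lift N ⟨2, hN⟩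
      ({ f₁ with commutes' := fun p => DFunLike.congr_fun hf₁ p } : B →ₐ[k[X]] C ⧸ N)
    have : IsScalarTower k k[X] C :=
      .of_algebraMap_eq' (by ext; simp [RingHom.algebraMap_toAlgebra])
    refine ⟨Ideal.Quotient.liftₐ _ (g.restrictScalars k) ?_, ?_⟩
    · intro b hb
      refine (Ideal.span_le (I := RingHom.ker g)).mpr ?_ hb
      rw [Set.singleton_subset_iff]
      exact (g.commutes _).trans hX
    · ext b
      obtain ⟨b, rfl⟩ := Ideal.Quotient.mk_surjective b
      exact DFunLike.congr_fun hg b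

/-! ### The representing algebra is the contraction algebra -/

section Laurent

variable {k A : Type*} [CommRing k] [CommRing A] [Algebra k A] {θ : A →ₐ[k] A}

attribute [local instance] laurentAlgebra

theorem isScalarTower_laurent : IsScalarTower k k[X] A[T;T⁻¹] :=
  .of_algebraMap_eq fun c => (Polynomial.aeval_C (LaurentPolynomial.T 2 : A[T;T⁻¹]) c).symm

attribute [local instance] isScalarTower_laurent

theorem algebraMap_X_laurent :
    algebraMap k[X] A[T;T⁻¹] Polynomial.X = LaurentPolynomial.T 2 :=
  Polynomial.aeval_X _

open LaurentPolynomial in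
/-- The homomorphism `a ↦ a₊ + s (a₋ / √t)` from `A` to `A[√t, 1/√t][s] / (s² - t)`, for `a₊` and
`a₋` the even and odd parts of `a`. -/
noncomputable def toQuadLaurent [Invertible (2 : k)] (θ : A →ₐ[k] A) :
    A →ₐ[k] Quad (Polynomial.X : k[X]) A[T;T⁻¹] where
  toFun a := ⟨C (evenPart θ a), C (oddPart θ a) * T (-1)⟩
  map_one' := by
    have h : (1 : A) ∈ invariants θ := map_one θ
    rw [evenPart_of_mem h, oddPart_of_mem_invariants h, map_one, map_zero, zero_mul]
    rfl
  map_zero' := by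
    simp only [map_zero, zero_mul]
    rfl
  map_add' a b := by
    rw [map_add, map_add, map_add, map_add, add_mul]
    rfl
  map_mul' a b := by
    have hT : (T 2 : A[T;T⁻¹]) * T (-1) * T (-1) = 1 := by
      rw [← T_add, ← T_add]
      exact T_zero
    rw [evenPart_mul, oddPart_mul, QuadraticAlgebra.mk_mul_mk]
    simp only [map_add, map_mul]
    refine QuadraticAlgebra.ext ?_ ?_ <;> dsimp only
    · rw [algebraMap_X_laurent]
      linear_combination -(C (oddPart θ a) * C (oddPart θ b)) * hT
    · ring
  commutes' c := by
    have h : algebraMap k A c ∈ invariants θ := θ.commutes c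
    rw [evenPart_of_mem h, oddPart_of_mem_invariants h, map_zero, zero_mul]
    rfl

theorem toQuadLaurent_map [Invertible (2 : k)] (hθ : Function.Involutive θ) (a : A) :
    toQuadLaurent θ (θ a) = Quad.conj k Polynomial.X (toQuadLaurent θ a) := by
  have h₁ : evenPart θ (θ a) = evenPart θ a := by
    rw [evenPart_apply, evenPart_apply, hθ a, add_comm]
  have h₂ : oddPart θ (θ a) = -oddPart θ a := by
    rw [oddPart_apply, oddPart_apply, hθ a, ← smul_neg, neg_sub]
  ext1
  · change LaurentPolynomial.C (evenPart θ (θ a)) = LaurentPolynomial.C (evenPart θ a)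
    rw [h₁]
  · change LaurentPolynomial.C (oddPart θ (θ a)) * LaurentPolynomial.T (-1) =
      -(LaurentPolynomial.C (oddPart θ a) * LaurentPolynomial.T (-1))
    rw [h₂, map_neg, neg_mul]

namespace HomogeneousGenerators

variable {ι κ : Type*} (G : HomogeneousGenerators θ ι κ)

theorem range_eq_contractionSubalgebra [Invertible (2 : k)] (hθ : Function.Involutive θ)
    (g : G.Model (Polynomial.X : k[X]) →ₐ[k[X]] A[T;T⁻¹])
    (hg : ∀ a, Quad.map k Polynomial.X g (G.universal Polynomial.X a) = toQuadLaurent θ a) :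
    g.range = contractionSubalgebra θ := by
  have hre (a : A) : g (G.universal Polynomial.X a).re = LaurentPolynomial.C (evenPart θ a) :=
    congr_arg QuadraticAlgebra.re (hg a)
  have him (a : A) : g (G.universal Polynomial.X a).im =
      LaurentPolynomial.C (oddPart θ a) * LaurentPolynomial.T (-1) :=
    congr_arg QuadraticAlgebra.im (hg a)
  rw [← Algebra.map_top, ← G.adjoin_coordinates, AlgHom.map_adjoin, contractionSubalgebra]
  congr 1
  ext x
  constructor
  · rintro ⟨_, ⟨a, rfl⟩ | ⟨a, rfl⟩, rfl⟩
    · exact .inl ⟨_, evenPart_mem hθ a, hre a⟩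
    · exact .inr ⟨_, oddPart_mem hθ a, him a⟩
  · rintro (⟨a, ha, rfl⟩ | ⟨a, ha, rfl⟩)
    · refine ⟨_, .inl ⟨a, rfl⟩, ?_⟩
      rw [hre, evenPart_of_mem ha]
    · refine ⟨_, .inr ⟨a, rfl⟩, ?_⟩
      rw [him, oddPart_of_mem ha]

/-- The universal homomorphism extends to a homomorphism from `A[√t, 1/√t]` to the localization of
`𝐁[s] / (s² - t)` at `s`, for `𝐁` the representing algebra. As `t` is not a zero divisor of `𝐁`,
neither is `s`, and so `𝐁` embeds in this localization through `A[√t, 1/√t]`. -/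
theorem injective_of_isSMulRegular [Invertible (2 : k)]
    (hreg : IsSMulRegular (G.Model (Polynomial.X : k[X])) (Polynomial.X : k[X]))
    (g : G.Model (Polynomial.X : k[X]) →ₐ[k[X]] A[T;T⁻¹])
    (hg : ∀ a, Quad.map k Polynomial.X g (G.universal Polynomial.X a) = toQuadLaurent θ a) :
    Function.Injective g := by
  let Q := Quad (Polynomial.X : k[X]) (G.Model (Polynomial.X : k[X]))
  let s : Q := QuadraticAlgebra.omega
  have hs : s * s = algebraMap k[X] Q Polynomial.X := by
    ext
    · simp [s, Q]
      rfl
    · simp [s, Q]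
      rfl
  have hs_mem : Submonoid.powers s ≤ nonZeroDivisors Q := by
    rw [Submonoid.powers_le, mem_nonZeroDivisors_iff_right]
    intro z hz
    have h₁ : z.re = 0 := by
      have := congr_arg QuadraticAlgebra.im hz
      rw [QuadraticAlgebra.im_mul] at this
      simpa [s] using this
    have h₂ : algebraMap k[X] _ Polynomial.X * z.im = 0 := by
      have := congr_arg QuadraticAlgebra.re hz
      rw [QuadraticAlgebra.re_mul] at this
      simpa [s] using this
    rw [← Algebra.smul_def] at h₂
    exact QuadraticAlgebra.ext h₁ (hreg.right_eq_zero_of_smul h₂)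
  let S := Localization.Away s
  have hinj : Function.Injective (algebraMap Q S) := IsLocalization.injective S hs_mem
  let u : Sˣ := (IsLocalization.Away.algebraMap_isUnit (S := S) s).unit
  have hu : (u : S) = algebraMap Q S s := rfl
  let e : A[T;T⁻¹] →+* S := LaurentPolynomial.eval₂
    ((algebraMap Q S).comp (G.universal (Polynomial.X : k[X])).toRingHom) u
  have heC (a : A) : e (LaurentPolynomial.C a) =
    algebraMap Q S (G.universal (Polynomial.X : k[X]) a) := LaurentPolynomial.eval₂_C _ _ _
  have heT (n : ℤ) : e (LaurentPolynomial.T n) = (u ^ n : Sˣ) := LaurentPolynomial.eval₂_T _ _ _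
  have hre (a : A) : g (G.universal Polynomial.X a).re = LaurentPolynomial.C (evenPart θ a) :=
    congr_arg QuadraticAlgebra.re (hg a)
  have him (a : A) : g (G.universal Polynomial.X a).im =
      LaurentPolynomial.C (oddPart θ a) * LaurentPolynomial.T (-1) :=
    congr_arg QuadraticAlgebra.im (hg a)
  have heven (a : A) : G.universal (Polynomial.X : k[X]) (evenPart θ a) =
      algebraMap _ Q (G.universal (Polynomial.X : k[X]) a).re :=
    equivariant_evenPart (G.universal_map _) a
  have hodd (a : A) : G.universal (Polynomial.X : k[X]) (oddPart θ a) =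
      s * algebraMap _ Q (G.universal (Polynomial.X : k[X]) a).im := by
    rw [equivariant_oddPart (G.universal_map _), QuadraticAlgebra.algebraMap_eq,
      QuadraticAlgebra.omega_mul_mk, mul_zero, zero_mul, add_zero]
  have hbase : (e.comp (algebraMap k[X] A[T;T⁻¹])) =
      (algebraMap Q S).comp (algebraMap k[X] Q) := by
    refine Polynomial.ringHom_ext (fun c => ?_) ?_
    · have h₁ : algebraMap k[X] A[T;T⁻¹] (Polynomial.C c) =
          LaurentPolynomial.C (algebraMap k A c) := Polynomial.aeval_C _ c
      rw [RingHom.comp_apply, RingHom.comp_apply, h₁, heC, AlgHom.commutes]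
      rfl
    · rw [RingHom.comp_apply, RingHom.comp_apply, algebraMap_X_laurent, heT, ← hs, map_mul, ← hu,
        ← Units.val_mul, ← zpow_two]
  have hcomp (z : G.Model (Polynomial.X : k[X])) : e (g z) = algebraMap Q S (algebraMap _ Q z) := by
    have hz : z ∈ Algebra.adjoin k[X] (G.coordinates (Polynomial.X : k[X])) := by
      rw [adjoin_coordinates]
      trivial
    induction hz using Algebra.adjoin_induction with
    | mem z hz =>
      rcases hz with ⟨a, rfl⟩ | ⟨a, rfl⟩
      · dsimp only
        rw [hre, heC, heven]
      · dsimp only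
        rw [him, map_mul, heC, heT, hodd, map_mul, mul_right_comm, ← hu, zpow_neg_one,
          Units.mul_inv, one_mul]
    | algebraMap p =>
      rw [AlgHom.commutes]
      exact DFunLike.congr_fun hbase p
    | add x y _ _ hx hy => simp only [map_add, hx, hy]
    | mul x y _ _ hx hy => simp only [map_mul, hx, hy]
  have : Function.Injective (e ∘ g) := by
    rw [show e ∘ g = algebraMap Q S ∘ algebraMap _ Q from funext hcomp]
    exact hinj.comp QuadraticAlgebra.algebraMap_injective
  exact this.of_comp

theorem nonempty_algEquiv_contractionAlgebra [Invertible (2 : k)] (hθ : Function.Involutive θ)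
    [Finite ι] [Finite κ] [Algebra.Smooth k A] :
    Nonempty (G.Model (Polynomial.X : k[X]) ≃ₐ[k[X]] ContractionAlgebra θ) := by
  have : Algebra.Smooth k[X] (G.Model (Polynomial.X : k[X])) := G.smooth_model _ hθ
  have hreg : IsSMulRegular (G.Model (Polynomial.X : k[X])) (Polynomial.X : k[X]) :=
    Module.Flat.isSMulRegular_of_nonZeroDivisors Polynomial.X_mem_nonzeroDivisors
  obtain ⟨g, hg⟩ := G.exists_lift (Polynomial.X : k[X]) (toQuadLaurent θ) (toQuadLaurent_map hθ)
  exact ⟨(AlgEquiv.ofInjective g (G.injective_of_isSMulRegular hreg g hg)).trans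
    (Subalgebra.equivOfEq _ _ (G.range_eq_contractionSubalgebra hθ g hg))⟩

end HomogeneousGenerators

end Laurent

/-! ### The fiber at zero is the symmetric algebra of the conormal module -/

section Fiber

variable {k A : Type*} [CommRing k] [CommRing A] [Algebra k A] {θ : A →ₐ[k] A}

theorem evenPart_mem_antiIdeal_sq [Invertible (2 : k)] (hθ : Function.Involutive θ) {a : A}
    (ha : a ∈ antiIdeal θ) : evenPart θ a ∈ antiIdeal θ ^ 2 := by
  have hodd (a : A) : oddPart θ a ∈ antiIdeal θ := Ideal.subset_span (oddPart_mem hθ a)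
  refine Submodule.span_induction (p := fun a _ => evenPart θ a ∈ antiIdeal θ ^ 2)
    (fun a ha => ?_) ?_ (fun a b _ _ ha hb => ?_) (fun b a _ ha => ?_)
    (show a ∈ Submodule.span A (antiInvariants θ) from ha)
  · rw [evenPart_of_mem_antiInvariants ha]
    exact Ideal.zero_mem _
  · rw [map_zero]
    exact Ideal.zero_mem _
  · rw [map_add]
    exact Ideal.add_mem _ ha hb
  · rw [smul_eq_mul, evenPart_mul]
    refine Ideal.add_mem _ (Ideal.mul_mem_left _ _ ha) ?_
    rw [pow_two]
    exact Ideal.mul_mem_mul (hodd b) (hodd a)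

/-- The class in `I / I²` of the odd part of an element; a derivation of `A`. -/
noncomputable def oddClass [Invertible (2 : k)] (hθ : Function.Involutive θ) (a : A) :
    (antiIdeal θ).Cotangent :=
  (antiIdeal θ).toCotangent ⟨oddPart θ a, Ideal.subset_span (oddPart_mem hθ a)⟩

section OddClass

variable [Invertible (2 : k)] (hθ : Function.Involutive θ)

theorem oddClass_of_mem_invariants {a : A} (ha : a ∈ invariants θ) : oddClass hθ a = 0 := by
  rw [oddClass, Ideal.toCotangent_eq_zero]
  simp only [oddPart_of_mem_invariants ha, Ideal.zero_mem]

theorem oddClass_add (a b : A) : oddClass hθ (a + b) = oddClass hθ a + oddClass hθ b := by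
  rw [oddClass, oddClass, oddClass, ← map_add, Ideal.toCotangent_eq]
  simp

theorem oddClass_mul (a b : A) :
    oddClass hθ (a * b) = a • oddClass hθ b + b • oddClass hθ a := by
  rw [oddClass, oddClass, oddClass, ← map_smul, ← map_smul, ← map_add, Ideal.toCotangent_eq]
  simp only [Submodule.coe_add, Submodule.coe_smul, smul_eq_mul, oddPart_mul]
  have h : oddPart θ a * oddPart θ b ∈ antiIdeal θ ^ 2 := by
    rw [pow_two]
    exact Ideal.mul_mem_mul (Ideal.subset_span (oddPart_mem hθ a))
      (Ideal.subset_span (oddPart_mem hθ b))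
  convert Ideal.mul_mem_left _ (-2) h using 1
  linear_combination oddPart θ b * evenPart_add_oddPart θ a +
    oddPart θ a * evenPart_add_oddPart θ b

theorem oddClass_of_mem {a : A} (ha : a ∈ antiIdeal θ) :
    oddClass hθ a = (antiIdeal θ).toCotangent ⟨a, ha⟩ := by
  rw [oddClass, Ideal.toCotangent_eq, ← neg_mem_iff, neg_sub]
  have : a - oddPart θ a = evenPart θ a := sub_eq_of_eq_add (evenPart_add_oddPart θ a).symm
  rw [this]
  exact evenPart_mem_antiIdeal_sq hθ ha

end OddClass

namespace SymCotangent

variable {I : Ideal A}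

variable (I) in
/-- The inclusion of `I / I²` into its symmetric algebra. -/
noncomputable def ι : I.Cotangent →ₗ[A ⧸ I] SymCotangent I :=
  SymmetricAlgebra.ι (A ⧸ I) I.Cotangent

theorem ι_smul (a : A) (m : I.Cotangent) :
    ι I (a • m) = algebraMap (A ⧸ I) (SymCotangent I) (Ideal.Quotient.mk I a) * ι I m := by
  rw [← Algebra.smul_def, ← map_smul]
  rfl

theorem algHom_ext {C : Type*} [CommRing C] [Algebra k C] {f g : SymCotangent I →ₐ[k] C}
    (h₀ : ∀ a : A, f (algebraMap (A ⧸ I) _ (Ideal.Quotient.mk I a)) =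
      g (algebraMap (A ⧸ I) _ (Ideal.Quotient.mk I a)))
    (h₁ : ∀ x : I, f (ι I (I.toCotangent x)) = g (ι I (I.toCotangent x))) : f = g := by
  ext z
  refine SymmetricAlgebra.induction (R := A ⧸ I) (M := I.Cotangent)
    (motive := fun z : SymCotangent I => f z = g z) (fun a => ?_) (fun m => ?_)
    (fun x y hx hy => ?_) (fun x y hx hy => ?_) z
  · obtain ⟨a, rfl⟩ := Ideal.Quotient.mk_surjective a
    exact h₀ a
  · obtain ⟨x, rfl⟩ := I.toCotangent_surjective m
    exact h₁ x
  · exact (map_mul f x y).trans ((congr_arg₂ _ hx hy).trans (map_mul g x y).symm)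
  · exact (map_add f x y).trans ((congr_arg₂ _ hx hy).trans (map_add g x y).symm)

/-- The symmetric algebra is an algebra over `k[t]` on which `t` acts by zero. -/
noncomputable abbrev polynomialAlgebra (I : Ideal A) : Algebra k[X] (SymCotangent I) :=
  (Polynomial.aeval (R := k) (0 : SymCotangent I)).toRingHom.toAlgebra

attribute [local instance] polynomialAlgebra

theorem isScalarTower_polynomial : IsScalarTower k k[X] (SymCotangent I) :=
  .of_algebraMap_eq fun c => (Polynomial.aeval_C (0 : SymCotangent I) c).symm

attribute [local instance] isScalarTower_polynomial

theorem algebraMap_X : algebraMap k[X] (SymCotangent I) Polynomial.X = 0 :=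
  Polynomial.aeval_X _

/-- The homomorphism `a ↦ [a] + s [a₋]` from `A` to `Sym(I / I²)[s] / (s²)`, for `a₋` the odd part
of `a`. -/
noncomputable def ofAlgebra [Invertible (2 : k)] (hθ : Function.Involutive θ) :
    A →ₐ[k] Quad (Polynomial.X : k[X]) (SymCotangent (antiIdeal θ)) where
  toFun a := ⟨algebraMap (A ⧸ antiIdeal θ) _ (Ideal.Quotient.mk _ a), ι _ (oddClass hθ a)⟩
  map_one' := by
    rw [oddClass_of_mem_invariants hθ (map_one θ), map_one, map_one, map_zero]
    rfl
  map_zero' := by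
    rw [oddClass_of_mem_invariants hθ (map_zero θ), map_zero, map_zero, map_zero]
    rfl
  map_add' a b := by
    rw [oddClass_add, map_add, map_add, map_add]
    rfl
  map_mul' a b := by
    rw [oddClass_mul, map_add, ι_smul, ι_smul, QuadraticAlgebra.mk_mul_mk]
    refine QuadraticAlgebra.ext ?_ ?_ <;> dsimp only
    · rw [algebraMap_X, map_mul, map_mul]
      ring
    · ring
  commutes' c := by
    rw [oddClass_of_mem_invariants hθ (θ.commutes c), map_zero]
    rfl

theorem ofAlgebra_map [Invertible (2 : k)] (hθ : Function.Involutive θ) (a : A) :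
    ofAlgebra hθ (θ a) = Quad.conj k Polynomial.X (ofAlgebra hθ a) := by
  have h₁ : a = evenPart θ a + oddPart θ a := (evenPart_add_oddPart θ a).symm
  have h₂ : θ a = evenPart θ a - oddPart θ a := by
    conv_lhs => rw [h₁, map_add, show θ (evenPart θ a) = _ from evenPart_mem hθ a,
      show θ (oddPart θ a) = _ from oddPart_mem hθ a, ← sub_eq_add_neg]
  have he : (ofAlgebra hθ (evenPart θ a)).im = 0 := by
    change ι _ (oddClass hθ _) = 0
    rw [oddClass_of_mem_invariants hθ (evenPart_mem hθ a), map_zero]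
  have ho : (ofAlgebra hθ (oddPart θ a)).re = 0 := by
    change algebraMap (A ⧸ antiIdeal θ) _ (Ideal.Quotient.mk _ _) = 0
    rw [Ideal.Quotient.eq_zero_iff_mem.mpr
      (show oddPart θ a ∈ antiIdeal θ from Ideal.subset_span (oddPart_mem hθ a)), map_zero]
  rw [h₂]
  conv_rhs => rw [h₁]
  rw [map_sub, map_add]
  ext
  · simp [ho]
  · simp [he]

/-- An equivariant homomorphism `φ : A → B[s] / (s²)` maps `A` to `B` by its constant coefficient,
and `I / I²` by its coefficient at `s`; this defines a homomorphism from the symmetric algebra. -/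
theorem exists_lift [Invertible (2 : k)] {R B : Type*} [CommRing R] {t : R}
    [CommRing B] [Algebra R B] [Algebra k B] (ht : algebraMap R B t = 0)
    {φ : A →ₐ[k] Quad t B} (hφ : ∀ a, φ (θ a) = Quad.conj k t (φ a)) :
    ∃ h : SymCotangent (antiIdeal θ) →ₐ[k] B,
      (∀ a, h (algebraMap (A ⧸ antiIdeal θ) _ (Ideal.Quotient.mk _ a)) = (φ a).re) ∧
      ∀ x : antiIdeal θ, h (ι _ ((antiIdeal θ).toCotangent x)) = (φ x).im := by
  have hre_mul (a b : A) : (φ (a * b)).re = (φ a).re * (φ b).re := by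
    rw [map_mul, QuadraticAlgebra.re_mul]
    linear_combination (φ a).im * (φ b).im * ht
  have him_mul (a b : A) : (φ (a * b)).im = (φ a).re * (φ b).im + (φ a).im * (φ b).re := by
    rw [map_mul, QuadraticAlgebra.im_mul, zero_mul, zero_mul, add_zero]
  let ρ : A →ₐ[k] B :=
    { toFun := fun a => (φ a).re
      map_one' := by rw [map_one]; rfl
      map_zero' := by rw [map_zero]; rfl
      map_add' := fun a b => by rw [map_add]; rfl
      map_mul' := hre_mul
      commutes' := fun c => by rw [AlgHom.commutes]; rfl }
  have hρ : antiIdeal θ ≤ RingHom.ker ρ := by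
    refine Ideal.span_le.mpr fun a ha => ?_
    have := equivariant_oddPart hφ a
    rw [oddPart_of_mem ha] at this
    exact congr_arg QuadraticAlgebra.re this
  let ρ' : A ⧸ antiIdeal θ →ₐ[k] B := Ideal.Quotient.liftₐ _ ρ hρ
  let : Algebra (A ⧸ antiIdeal θ) B := ρ'.toRingHom.toAlgebra
  let : Algebra A B := ρ.toRingHom.toAlgebra
  have : IsScalarTower A (A ⧸ antiIdeal θ) B := .of_algebraMap_eq fun _ => rfl
  have hsmul (a : A) (b : B) : a • b = (φ a).re * b := rfl
  let f : antiIdeal θ →ₗ[A] B :=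
    { toFun := fun x => (φ x).im
      map_add' := fun x y => by rw [Submodule.coe_add, map_add]; rfl
      map_smul' := fun a x => by
        rw [Submodule.coe_smul, smul_eq_mul, him_mul, show (φ x).re = 0 from hρ x.2, mul_zero,
          add_zero]
        rfl }
  have hf (x y : antiIdeal θ) : f (x * y) = 0 := by
    change (φ (x * y)).im = 0
    rw [him_mul, show (φ x).re = 0 from hρ x.2, show (φ y).re = 0 from hρ y.2, zero_mul, mul_zero,
      add_zero]
  let f' : (antiIdeal θ).Cotangent →ₗ[A ⧸ antiIdeal θ] B :=
    (Ideal.Cotangent.lift f hf).extendScalarsOfSurjective Ideal.Quotient.mk_surjective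
  let h : SymCotangent (antiIdeal θ) →ₐ[A ⧸ antiIdeal θ] B := SymmetricAlgebra.lift f'
  refine ⟨{ h with commutes' := fun c => ?_ }, fun a => h.commutes _, fun x => ?_⟩
  · exact (h.commutes (algebraMap k (A ⧸ antiIdeal θ) c)).trans (ρ'.commutes c)
  · exact SymmetricAlgebra.lift_ι_apply (f := f') _

end SymCotangent

open SymCotangent

attribute [local instance] polynomialAlgebra isScalarTower_polynomial

/-- Let `Φ : A → B[s] / (s² - t)` be an equivariant homomorphism whose coordinates generate `B`. If
it specializes to the homomorphism `SymCotangent.ofAlgebra`, then it is universal over `t = 0`. -/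
theorem nonempty_fiber_algEquiv_symCotangent [Invertible (2 : k)] (hθ : Function.Involutive θ)
    {B : Type*} [CommRing B] [Algebra k[X] B] [Algebra k B] [IsScalarTower k k[X] B]
    {Φ : A →ₐ[k] Quad (Polynomial.X : k[X]) B}
    (hΦ : ∀ a, Φ (θ a) = Quad.conj k Polynomial.X (Φ a))
    (hadjoin : Algebra.adjoin k[X]
      (Set.range (fun a => (Φ a).re) ∪ Set.range (fun a => (Φ a).im)) = ⊤)
    (g : B →ₐ[k[X]] SymCotangent (antiIdeal θ))
    (hg : ∀ a, Quad.map k Polynomial.X g (Φ a) = ofAlgebra hθ a) :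
    Nonempty ((B ⧸ Ideal.span {algebraMap k[X] B Polynomial.X}) ≃ₐ[k]
      SymCotangent (antiIdeal θ)) := by
  let J : Ideal B := Ideal.span {algebraMap k[X] B Polynomial.X}
  have hJ : algebraMap k[X] (B ⧸ J) Polynomial.X = 0 :=
    Ideal.Quotient.eq_zero_iff_mem.mpr (Ideal.subset_span (Set.mem_singleton _))
  have hgre (a : A) : g (Φ a).re =
      algebraMap (A ⧸ antiIdeal θ) _ (Ideal.Quotient.mk _ a) :=
    congr_arg QuadraticAlgebra.re (hg a)
  have hgim (a : A) : g (Φ a).im = ι _ (oddClass hθ a) :=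
    congr_arg QuadraticAlgebra.im (hg a)
  have hgJ : J ≤ RingHom.ker g := by
    rw [Ideal.span_le, Set.singleton_subset_iff]
    exact (g.commutes _).trans algebraMap_X
  let p : (B ⧸ J) →ₐ[k] SymCotangent (antiIdeal θ) :=
    Ideal.Quotient.liftₐ J (g.restrictScalars k) hgJ
  let φ : A →ₐ[k] Quad (Polynomial.X : k[X]) (B ⧸ J) :=
    (Quad.map k Polynomial.X (Ideal.Quotient.mkₐ k[X] J)).comp Φ
  have hφ (a : A) : φ (θ a) = Quad.conj k Polynomial.X (φ a) := by
    change Quad.map k Polynomial.X _ (Φ (θ a)) = _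
    rw [hΦ]
    exact QuadraticAlgebra.ext rfl (map_neg (Ideal.Quotient.mk J) _)
  obtain ⟨h, hhre, hhim⟩ := SymCotangent.exists_lift hJ hφ
  have hcomm : (h : SymCotangent (antiIdeal θ) →+* (B ⧸ J)).comp
      (algebraMap k[X] (SymCotangent (antiIdeal θ))) =
      algebraMap k[X] (B ⧸ J) := by
    refine Polynomial.ringHom_ext (fun c => ?_) ?_
    · have h₁ : algebraMap k[X] (SymCotangent (antiIdeal θ)) (Polynomial.C c) = algebraMap k _ c :=
        Polynomial.aeval_C _ c
      have h₂ : algebraMap k[X] (B ⧸ J) (Polynomial.C c) = algebraMap k _ c :=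
        (IsScalarTower.algebraMap_apply k k[X] (B ⧸ J) c).symm
      rw [RingHom.comp_apply, h₁, h₂]
      exact h.commutes c
    · rw [RingHom.comp_apply, algebraMap_X, map_zero, hJ]
  let h' : SymCotangent (antiIdeal θ) →ₐ[k[X]] (B ⧸ J) :=
    { h with commutes' := fun q => DFunLike.congr_fun hcomm q }
  have hleft : h'.comp g = Ideal.Quotient.mkₐ k[X] J := by
    refine AlgHom.ext_of_adjoin_eq_top hadjoin ?_
    rintro _ (⟨a, rfl⟩ | ⟨a, rfl⟩)
    · change h (g _) = _
      rw [hgre, hhre]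
      rfl
    · change h (g _) = _
      rw [hgim, oddClass, hhim, equivariant_oddPart hφ]
      rfl
  refine ⟨AlgEquiv.ofAlgHom p h (SymCotangent.algHom_ext (fun a => ?_) fun x => ?_) ?_⟩
  · change p (h _) = _
    rw [hhre]
    exact hgre a
  · change p (h _) = ι _ _
    rw [hhim, ← oddClass_of_mem hθ x.2]
    exact hgim x
  · ext z
    obtain ⟨z, rfl⟩ := Ideal.Quotient.mk_surjective z
    exact DFunLike.congr_fun hleft z

/-- Both sides represent the equivariant homomorphisms `A → B[s] / (s²)`, for `k`-algebras `B`. -/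
theorem HomogeneousGenerators.nonempty_fiber_algEquiv_symCotangent {ι₀ κ : Type*}
    (G : HomogeneousGenerators θ ι₀ κ) [Invertible (2 : k)] (hθ : Function.Involutive θ) :
    Nonempty ((G.Model (Polynomial.X : k[X]) ⧸
        Ideal.span {algebraMap k[X] (G.Model (Polynomial.X : k[X])) Polynomial.X}) ≃ₐ[k]
      SymCotangent (antiIdeal θ)) := by
  obtain ⟨g, hg⟩ := G.exists_lift (Polynomial.X : k[X]) (ofAlgebra hθ) (ofAlgebra_map hθ)
  exact Contraction.nonempty_fiber_algEquiv_symCotangent hθ (G.universal_map _)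
    (G.adjoin_coordinates _) g hg

end Fiber

end Contraction

theorem theorem2 {k : Type*} {A : Type*} [CommRing k] [CommRing A] [Algebra k A]
    (h2 : IsUnit (2 : k)) (θ : A →ₐ[k] A) (hθ : Function.Involutive θ)
    [Algebra.Smooth k A] :
    (Nonempty (Contraction.FiberZero θ ≃ₐ[k]
        Contraction.SymCotangent (Contraction.antiIdeal θ)) ∧
      Algebra.Smooth k (Contraction.FiberZero θ)) ∧
    Algebra.Smooth k[X] (Contraction.ContractionAlgebra θ) := by
  have : Invertible (2 : k) := h2.invertible
  obtain ⟨n, ⟨G⟩⟩ := Contraction.exists_homogeneousGenerators hθ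
  obtain ⟨e⟩ := G.nonempty_algEquiv_contractionAlgebra hθ
  obtain ⟨e₀⟩ := G.nonempty_fiber_algEquiv_symCotangent hθ
  have : Algebra.Smooth k[X] (G.Model (Polynomial.X : k[X])) := G.smooth_model _ hθ
  have hA : Algebra.Smooth k[X] (Contraction.ContractionAlgebra θ) := .of_equiv e
  refine ⟨⟨⟨?_⟩, Contraction.smooth_fiber_zero⟩, hA⟩
  refine (Ideal.quotientEquivAlg _ _ (e.restrictScalars k).symm ?_).trans e₀
  rw [Ideal.map_span, Set.image_singleton]
  congr 2
  exact (e.symm.commutes _).symm
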